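/- Let $X$ be an uncountable Polish space. Baire class $0$ functions $X\to\mathbb R$ are the continuous ones, and for $0<\xi<\omega_1$ a function is of Baire class $\xi$ if it is the pointwise limit of functions $f_n$ of Baire classes $\xi_n<\xi$. For a map $D$ on closed subsets of $X$ that is monotone and satisfies $D(F)\subseteq F$, put $D^0(F)=F$, $D^{\eta+1}(F)=D(D^\eta(F))$ and $D^\eta(F)=\bigcap_{\theta<\eta}D^\theta(F)$ for limit $\eta$; let $\mathrm{rk}(D)$ be the least $\eta$ with $D^\eta(X)=\emptyset$, and $\omega_1$ if there is none. For a Baire class $1$ function $f$ define: (1) the separation rank $\alpha(f)=\sup_{p<q,\ p,q\in\mathbb Q}\mathrm{rk}(D_{\{f\le p\},\{f\ge q\}})$, where $D_{A,B}(F)=\overline{F\cap A}\cap\overline{F\cap B}$; (2) the oscillation rank $\beta(f)=\sup_{\varepsilon>0}\mathrm{rk}(D_{f,\varepsilon})$, where $D_{f,\varepsilon}(F)$ is the set of $x\in F$ with $\inf_{U\ni x\text{ open}}\ \sup_{x_1,x_2\in U\cap F}|f(x_1)-f(x_2)|\ge\varepsilon$; (3) the convergence rank $\gamma(f)=\min\sup_{\varepsilon>0}\mathrm{rk}(D_{(f_n),\varepsilon})$,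 the minimum being over all sequences $(f_n)$ of continuous functions converging pointwise to $f$, where $D_{(f_n),\varepsilon}(F)$ is the set of $x\in F$ with $\inf_{U\ni x\text{ open}}\ \inf_{N}\ \sup\{|f_m(y)-f_n(y)|:n,m\ge N,\ y\in U\cap F\}\ge\varepsilon$. For $\rho\in\{\alpha,\beta,\gamma\}$ define limit ranks $\overline\rho_\xi$ on the Baire class $\xi$ functions as follows. Let $\overline\rho_1=\rho$ (and let $\overline\rho_0$ be the restriction of $\rho$ to the continuous functions). For $\xi\ge1$ let $$\overline\rho_{\xi+1}(f)=\min\Big\{\sup_n\overline\rho_\xi(f_n): f_n\to f\text{ pointwise},\ f_n\text{ of Baire class }\xi\Big\}.$$ For a limit ordinal $\xi$ let $$\overline\rho_\xi(f)=\min\Big\{\sup_n\overline\rho_{\xi_n}(f_n): f_n\to f\text{ pointwise},\ \xi_n<\xi,\ f_n\text{ of Baire class }\xi_n\text{ but of no Baire class }\zeta<\xi_n\Big\}.$$ Theorem. If $2\le\xi<\omega_1$, then for every Baire class $\xi$ function $f:X\to\mathbb R$, $$\overline\alpha_\xi(f)\le\overline\beta_\xi(f)\le\overline\gamma_\xi(f)\le\omega.$$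 -/

import Mathlib

open scoped Ordinal ENNReal Topology

noncomputable section

namespace BaireRanks

universe u

variable {X : Type u}

/-- The iterated derivatives `D^η(F)` of a set `F`: `D^0(F) = F`, `D^(η+1)(F) = D(D^η(F))`, and
intersections at limit stages. -/
def iterDeriv (D : Set X → Set X) (F : Set X) (η : Ordinal.{0}) : Set X :=
  Ordinal.limitRecOn η F (fun _ S => D S) (fun η _ S => ⋂ (θ : Ordinal.{0}) (h : θ < η), S θ h)

open Classical in
/-- The rank of a derivative `D`: the least `η` with `D^η(X) = ∅` if there is one, and `ω₁`
otherwise. -/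
def derivRank (D : Set X → Set X) : Ordinal.{0} :=
  if ∃ η : Ordinal.{0}, iterDeriv D Set.univ η = ∅ then
    sInf {η : Ordinal.{0} | iterDeriv D Set.univ η = ∅}
  else Ordinal.omega 1

variable [TopologicalSpace X]

/-- `IsBaireClass ξ f`: the function `f : X → ℝ` is of Baire class `ξ`. Class `0` consists of the
continuous functions; `f` is of class `ξ` if it is the pointwise limit of a sequence of functions
each of which is of some class strictly below `ξ`. -/
inductive IsBaireClass : Ordinal.{0} → (X → ℝ) → Prop
  | continuous (f : X → ℝ) (hf : Continuous f) : IsBaireClass 0 f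
  | limit (ξ : Ordinal.{0}) (f : X → ℝ) (c : ℕ → Ordinal.{0}) (g : ℕ → X → ℝ)
      (hc : ∀ n, c n < ξ) (hg : ∀ n, IsBaireClass (c n) (g n))
      (hlim : ∀ x, Filter.Tendsto (fun n => g n x) Filter.atTop (𝓝 (f x))) : IsBaireClass ξ f

/-! All ranks below take values in `WithTop Ordinal`, a complete linear order, so that suprema and
infima carry no junk values: the infimum over an empty family is `⊤`, and the infimum over a
nonempty family is attained, that is, it is a minimum. -/

/-- The derivative `D_{A,B}(F)`, the intersection of the closures of `F ∩ A` and `F ∩ B`. -/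
def sepDeriv (A B F : Set X) : Set X := closure (F ∩ A) ∩ closure (F ∩ B)

/-- The separation rank `α(f)`. -/
def sepRank (f : X → ℝ) : WithTop Ordinal.{0} :=
  ⨆ (p : ℚ) (q : ℚ) (_ : p < q),
    (derivRank (sepDeriv {x | f x ≤ (p : ℝ)} {x | (q : ℝ) ≤ f x}) : WithTop Ordinal.{0})

/-- The oscillation of `f` at `x` restricted to `F` (possibly infinite). -/
def osc (f : X → ℝ) (x : X) (F : Set X) : ℝ≥0∞ :=
  ⨅ (U : Set X) (_ : IsOpen U) (_ : x ∈ U),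
    ⨆ (x₁ ∈ U ∩ F) (x₂ ∈ U ∩ F), ENNReal.ofReal |f x₁ - f x₂|

/-- The derivative `D_{f,ε}`. -/
def oscDeriv (f : X → ℝ) (ε : ℝ) (F : Set X) : Set X :=
  {x | x ∈ F ∧ ENNReal.ofReal ε ≤ osc f x F}

/-- The oscillation rank `β(f)`. -/
def oscRank (f : X → ℝ) : WithTop Ordinal.{0} :=
  ⨆ (ε : ℝ) (_ : 0 < ε), (derivRank (oscDeriv f ε) : WithTop Ordinal.{0})

/-- The oscillation of a sequence of functions at `x` restricted to `F` (possibly infinite). -/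
def seqOsc (g : ℕ → X → ℝ) (x : X) (F : Set X) : ℝ≥0∞ :=
  ⨅ (U : Set X) (_ : IsOpen U) (_ : x ∈ U) (N : ℕ),
    ⨆ (n : ℕ) (_ : N ≤ n) (m : ℕ) (_ : N ≤ m) (y ∈ U ∩ F), ENNReal.ofReal |g m y - g n y|

/-- The derivative `D_{(g_n),ε}`. -/
def seqOscDeriv (g : ℕ → X → ℝ) (ε : ℝ) (F : Set X) : Set X :=
  {x | x ∈ F ∧ ENNReal.ofReal ε ≤ seqOsc g x F}

/-- The convergence rank `γ(f)`. -/
def convRank (f : X → ℝ) : WithTop Ordinal.{0} :=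
  ⨅ (g : ℕ → X → ℝ) (_ : ∀ n, Continuous (g n))
    (_ : ∀ x, Filter.Tendsto (fun n => g n x) Filter.atTop (𝓝 (f x))),
    ⨆ (ε : ℝ) (_ : 0 < ε), (derivRank (seqOscDeriv g ε) : WithTop Ordinal.{0})

open Classical in
/-- The limit rank of level `ξ` built from a rank `ρ` on the Baire class 1 functions.
Level `1` is `ρ`; level `0`, which only concerns continuous functions occurring in approximating
sequences at limit levels, is `ρ` too. At a successor `η + 1` with `η ≠ 0` one minimizes over
sequences of functions of class `η`; at a limit level `ξ`, over sequences of functions `g n` whose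
exact Baire class `c n` is below `ξ`. -/
def limitRank (ρ : (X → ℝ) → WithTop Ordinal.{0}) (ξ : Ordinal.{0}) :
    (X → ℝ) → WithTop Ordinal.{0} :=
  Ordinal.limitRecOn ξ ρ
    (fun η r => if η = 0 then ρ else fun f =>
      ⨅ (g : ℕ → X → ℝ) (_ : ∀ n, IsBaireClass η (g n))
        (_ : ∀ x, Filter.Tendsto (fun n => g n x) Filter.atTop (𝓝 (f x))),
        ⨆ n, r (g n))
    (fun ξ _ r f =>
      ⨅ (g : ℕ → X → ℝ) (c : ℕ → Ordinal.{0}) (hc : ∀ n, c n < ξ)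
        (_ : ∀ n, IsBaireClass (c n) (g n))
        (_ : ∀ n, ∀ ζ < c n, ¬ IsBaireClass ζ (g n))
        (_ : ∀ x, Filter.Tendsto (fun n => g n x) Filter.atTop (𝓝 (f x))),
        ⨆ n, r (c n) (hc n) (g n))

end BaireRanks

end

open Filter Set

namespace BaireRanks

universe u

variable {X : Type u}

/-! The first two inequalities hold because the derivatives compare, `sepDeriv` inside `oscDeriv`
inside `seqOscDeriv` with adjusted ε, and `limitRank_mono` carries base inequalities to every level.

The bound ω is decided at level 2. Let f = lim b k with b k = lim a k l and a k l continuous. For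
precision 2⁻ʲ, an index k is valid at x if |b m x - b k x| ≤ 2⁻ʲ for all m ≥ k. Validity is tested
at stage n by an open set `notRefuted`, and the least unrefuted index stabilizes at the least valid
one. Telescoping along these indices, with truncated increments, gives functions g n → f
(`tendsto_clamp_diagonal`). Each g n depends only on finitely many closed refutation sets and is
continuous once one knows which of them contain x. Such a function has finite convergence rank
(`convRank_cell_le`): each derivative forces membership in one more closed set. Higher levels follow
by induction. -/

@[simp] lemma iterDeriv_zero (D : Set X → Set X) (F : Set X) : iterDeriv D F 0 = F := by
  simp [iterDeriv]

lemma iterDeriv_add_one (D : Set X → Set X) (F : Set X) (η : Ordinal.{0}) :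
    iterDeriv D F (η + 1) = D (iterDeriv D F η) := by
  simp [iterDeriv]

lemma iterDeriv_limit (D : Set X → Set X) (F : Set X) {η : Ordinal.{0}}
    (hη : Order.IsSuccLimit η) :
    iterDeriv D F η = ⋂ (θ : Ordinal.{0}) (_ : θ < η), iterDeriv D F θ := by
  rw [iterDeriv, Ordinal.limitRecOn_limit _ _ _ _ hη]
  rfl

lemma derivRank_le {D : Set X → Set X} {η : Ordinal.{0}} (h : iterDeriv D univ η = ∅) :
    derivRank D ≤ η := by
  rw [derivRank, if_pos ⟨η, h⟩]
  exact csInf_le' h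

lemma iterDeriv_derivRank {D : Set X → Set X} {η : Ordinal.{0}} (h : iterDeriv D univ η = ∅) :
    iterDeriv D univ (derivRank D) = ∅ := by
  rw [derivRank, if_pos ⟨η, h⟩]
  exact csInf_mem (s := {η : Ordinal.{0} | iterDeriv D univ η = ∅}) ⟨η, h⟩

/-- If `E 0, E 1, …` dominates the finite iterates of a monotone derivative and `E N` is empty,
then the rank is finite. -/
lemma derivRank_le_natCast {D : Set X → Set X} (hD : Monotone D) (E : ℕ → Set X)
    (h0 : E 0 = univ) (hE : ∀ n, D (E n) ⊆ E (n + 1)) {N : ℕ} (hN : E N = ∅) :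
    derivRank D ≤ N := by
  have h : ∀ n : ℕ, iterDeriv D univ n ⊆ E n := by
    intro n
    induction n with
    | zero => simp [h0]
    | succ n ih =>
      rw [Nat.cast_add, Nat.cast_one, iterDeriv_add_one]
      exact (hD ih).trans (hE n)
  exact derivRank_le (subset_empty_iff.1 ((h N).trans hN.le))

/-! ### Iterated derivatives of closed sets in second countable spaces -/

section Closed

variable [TopologicalSpace X]

lemma isClosed_iterDeriv {D : Set X → Set X} (hD : ∀ F, IsClosed F → IsClosed (D F))
    (η : Ordinal.{0}) : IsClosed (iterDeriv D univ η) := by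
  induction η using Ordinal.limitRecOn with
  | zero => simp
  | add_one η ih => rw [iterDeriv_add_one]; exact hD _ ih
  | limit η hη ih =>
    rw [iterDeriv_limit D _ hη]
    exact isClosed_iInter fun θ => isClosed_iInter fun h => ih θ h

lemma iterDeriv_antitone {D : Set X → Set X} (hD : ∀ F, IsClosed F → IsClosed (D F))
    (hsub : ∀ F, IsClosed F → D F ⊆ F) : Antitone (iterDeriv D univ) := by
  intro θ η h
  induction η using Ordinal.limitRecOn with
  | zero => rw [nonpos_iff_eq_zero.1 h]
  | add_one η ih =>
    rcases h.lt_or_eq with h | rfl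
    · rw [iterDeriv_add_one]
      exact (hsub _ (isClosed_iterDeriv hD η)).trans (ih (Order.lt_add_one_iff.1 h))
    · exact le_rfl
  | limit η hη ih =>
    rcases h.lt_or_eq with h | rfl
    · rw [iterDeriv_limit D _ hη]
      exact iInter₂_subset θ h
    · exact le_rfl

/-- In a second countable space the iterated derivatives stabilize at a countable stage. -/
lemma exists_iterDeriv_stable [SecondCountableTopology X] {D : Set X → Set X}
    (hD : ∀ F, IsClosed F → IsClosed (D F)) (hsub : ∀ F, IsClosed F → D F ⊆ F) :
    ∃ σ < Ordinal.omega 1, ∀ η, σ ≤ η → iterDeriv D univ η = iterDeriv D univ σ := by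
  classical
  obtain ⟨b, hbc, -, hb⟩ := TopologicalSpace.exists_countable_basis X
  have := hbc.to_subtype
  -- For each basic open `B`, `e B` will be a countable stage at which `B` misses the derivative, if
  -- there is one. A point lost after the supremum σ would have a basic neighbourhood that had
  -- already missed stage `e B` ≤ σ.
  let P : Set X → Ordinal.{0} → Prop := fun B η =>
    η < Ordinal.omega 1 ∧ B ∩ iterDeriv D univ η = ∅
  have hω : ∀ B : Set X, ∃ η < Ordinal.omega 1, ∀ θ, P B θ → B ∩ iterDeriv D univ η = ∅ := by
    intro B
    by_cases h : ∃ θ, P B θ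
    · obtain ⟨θ, hθ⟩ := h
      exact ⟨θ, hθ.1, fun _ _ => hθ.2⟩
    · exact ⟨0, Ordinal.omega_pos 1, fun θ hθ => (h ⟨θ, hθ⟩).elim⟩
  choose e he he' using hω
  have hσ : ⨆ B : b, e B < Ordinal.omega 1 := Ordinal.iSup_lt_omega_one fun B => he B
  set σ := ⨆ B : b, e B with hσdef
  have hstep : iterDeriv D univ (σ + 1) = iterDeriv D univ σ := by
    refine (iterDeriv_antitone hD hsub (by simp)).antisymm fun x hx => ?_
    by_contra hx'
    obtain ⟨B, hB, hxB, hBs⟩ := hb.exists_subset_of_mem_open (a := x) hx'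
      (isClosed_iterDeriv hD (σ + 1)).isOpen_compl
    have h1 : P B (σ + 1) :=
      ⟨(Cardinal.isSuccLimit_omega 1).add_one_lt hσ, (disjoint_compl_left.mono_left hBs).inter_eq⟩
    have h2 := he' B _ h1
    have h3 : e B ≤ σ := le_ciSup (f := fun B : b => e B) (Ordinal.bddAbove_of_small) ⟨B, hB⟩
    have h4 : x ∈ B ∩ iterDeriv D univ (e B) := ⟨hxB, iterDeriv_antitone hD hsub h3 hx⟩
    rw [h2] at h4
    exact h4
  refine ⟨σ, hσ, fun η hη => ?_⟩
  induction η using Ordinal.limitRecOn with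
  | zero => rw [nonpos_iff_eq_zero.1 hη]
  | add_one η ih =>
    rcases hη.lt_or_eq with h | h
    · rw [iterDeriv_add_one, ih (Order.lt_add_one_iff.1 h), ← iterDeriv_add_one D, hstep]
    · rw [h]
  | limit η hlim ih =>
    refine (iterDeriv_antitone hD hsub hη).antisymm ?_
    rw [iterDeriv_limit D _ hlim]
    refine subset_iInter₂ fun θ hθ => ?_
    rcases le_total σ θ with h | h
    · exact (ih θ hθ h).ge
    · exact iterDeriv_antitone hD hsub h

lemma derivRank_le_omega_one [SecondCountableTopology X] {D : Set X → Set X}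
    (hD : ∀ F, IsClosed F → IsClosed (D F)) (hsub : ∀ F, IsClosed F → D F ⊆ F) :
    derivRank D ≤ Ordinal.omega 1 := by
  by_cases h : ∃ η : Ordinal.{0}, iterDeriv D univ η = ∅
  · obtain ⟨η, hη⟩ := h
    obtain ⟨σ, hσ, hst⟩ := exists_iterDeriv_stable hD hsub
    refine (derivRank_le ?_).trans hσ.le
    rcases le_total σ η with h | h
    · rw [← hst η h, hη]
    · exact subset_empty_iff.1 ((iterDeriv_antitone hD hsub h).trans hη.le)
  · rw [derivRank, if_neg h]

lemma iterDeriv_subset {D E : Set X → Set X} (hD : ∀ F, IsClosed F → IsClosed (D F))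
    (hE : Monotone E) (hDE : ∀ F, IsClosed F → D F ⊆ E F) (η : Ordinal.{0}) :
    iterDeriv D univ η ⊆ iterDeriv E univ η := by
  induction η using Ordinal.limitRecOn with
  | zero => simp
  | add_one η ih =>
    rw [iterDeriv_add_one, iterDeriv_add_one]
    exact (hDE _ (isClosed_iterDeriv hD η)).trans (hE ih)
  | limit η hη ih =>
    rw [iterDeriv_limit D _ hη, iterDeriv_limit E _ hη]
    exact iInter₂_mono ih

/-- The hypotheses on `D` concern closed sets only because `sepDeriv A B F ⊆ F` can fail otherwise.
-/
lemma derivRank_mono [SecondCountableTopology X] {D E : Set X → Set X}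
    (hD : ∀ F, IsClosed F → IsClosed (D F)) (hsub : ∀ F, IsClosed F → D F ⊆ F)
    (hE : Monotone E) (hDE : ∀ F, IsClosed F → D F ⊆ E F) :
    derivRank D ≤ derivRank E := by
  by_cases h : ∃ η : Ordinal.{0}, iterDeriv E univ η = ∅
  · obtain ⟨η, hη⟩ := h
    exact derivRank_le (subset_empty_iff.1
      ((iterDeriv_subset hD hE hDE _).trans (iterDeriv_derivRank hη).le))
  -- Here `derivRank E` takes its default value ω₁, so countable stabilization of `D` is needed.
  · rw [derivRank.eq_1 E, if_neg h]
    exact derivRank_le_omega_one hD hsub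

/-! ### Comparison of the three derivatives -/

lemma isClosed_sepDeriv (A B F : Set X) : IsClosed (sepDeriv A B F) :=
  isClosed_closure.inter isClosed_closure

lemma sepDeriv_subset (A B : Set X) {F : Set X} (hF : IsClosed F) : sepDeriv A B F ⊆ F :=
  inter_subset_left.trans (closure_minimal inter_subset_left hF)

lemma osc_mono (f : X → ℝ) (x : X) : Monotone (osc f x) := by
  intro F G h
  refine iInf₂_mono fun U _ => iInf_mono fun _ => ?_
  have hUF : U ∩ F ⊆ U ∩ G := inter_subset_inter_right U h
  exact (iSup₂_mono fun y _ => biSup_mono fun z hz => hUF hz).trans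
    (biSup_mono fun y hy => hUF hy)

lemma oscDeriv_mono (f : X → ℝ) (ε : ℝ) : Monotone (oscDeriv f ε) :=
  fun _ _ h _ hx => ⟨h hx.1, hx.2.trans (osc_mono f _ h)⟩

lemma oscDeriv_subset (f : X → ℝ) (ε : ℝ) (F : Set X) : oscDeriv f ε F ⊆ F := fun _ hx => hx.1

lemma osc_lt_iff {f : X → ℝ} {x : X} {F : Set X} {r : ℝ≥0∞} :
    osc f x F < r ↔ ∃ U : Set X, IsOpen U ∧ x ∈ U ∧
      ⨆ (x₁ ∈ U ∩ F) (x₂ ∈ U ∩ F), ENNReal.ofReal |f x₁ - f x₂| < r := by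
  simp only [osc, iInf_lt_iff, exists_prop]

lemma isClosed_oscDeriv (f : X → ℝ) (ε : ℝ) {F : Set X} (hF : IsClosed F) :
    IsClosed (oscDeriv f ε F) := by
  refine hF.inter (s₂ := {x | ENNReal.ofReal ε ≤ osc f x F}) ⟨?_⟩
  refine isOpen_iff_forall_mem_open.2 fun x hx => ?_
  obtain ⟨U, hU, hxU, h⟩ := osc_lt_iff.1 (not_le.1 hx)
  exact ⟨U, fun y hy => not_le.2 (osc_lt_iff.2 ⟨U, hU, hy, h⟩), hU, hxU⟩

lemma seqOsc_mono (g : ℕ → X → ℝ) (x : X) : Monotone (seqOsc g x) := by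
  intro F G h
  refine iInf₂_mono fun U _ => iInf₂_mono fun _ N => ?_
  refine iSup₂_mono fun n _ => iSup₂_mono fun m _ => ?_
  exact biSup_mono fun y hy => ⟨hy.1, h hy.2⟩

lemma seqOscDeriv_mono (g : ℕ → X → ℝ) (ε : ℝ) : Monotone (seqOscDeriv g ε) :=
  fun _ _ h _ hx => ⟨h hx.1, hx.2.trans (seqOsc_mono g _ h)⟩

lemma seqOsc_lt_iff {g : ℕ → X → ℝ} {x : X} {F : Set X} {r : ℝ≥0∞} :
    seqOsc g x F < r ↔ ∃ U : Set X, IsOpen U ∧ x ∈ U ∧ ∃ N : ℕ,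
      ⨆ (n : ℕ) (_ : N ≤ n) (m : ℕ) (_ : N ≤ m) (y ∈ U ∩ F),
        ENNReal.ofReal |g m y - g n y| < r := by
  simp only [seqOsc, iInf_lt_iff, exists_prop]

lemma sepDeriv_subset_oscDeriv (f : X → ℝ) (p q : ℝ) {F : Set X} (hF : IsClosed F) :
    sepDeriv {x | f x ≤ p} {x | q ≤ f x} F ⊆ oscDeriv f (q - p) F := by
  intro x hx
  refine ⟨sepDeriv_subset _ _ hF hx, le_iInf₂ fun U hU => le_iInf fun hxU => ?_⟩
  obtain ⟨y, hyU, hyF, hy⟩ := mem_closure_iff.1 hx.1 U hU hxU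
  obtain ⟨z, hzU, hzF, hz⟩ := mem_closure_iff.1 hx.2 U hU hxU
  refine le_trans ?_ (le_iSup₂_of_le (f := fun x₁ (_ : x₁ ∈ U ∩ F) => _) z ⟨hzU, hzF⟩
    (le_iSup₂_of_le (f := fun x₂ (_ : x₂ ∈ U ∩ F) => _) y ⟨hyU, hyF⟩ le_rfl))
  refine ENNReal.ofReal_le_ofReal (le_trans ?_ (le_abs_self _))
  simp only [mem_ofPred_eq] at hy hz
  linarith

/-- The separation rank is at most the oscillation rank. -/
lemma sepRank_le_oscRank [SecondCountableTopology X] (f : X → ℝ) : sepRank f ≤ oscRank f := by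
  refine iSup_le fun p => iSup₂_le fun q hpq => ?_
  refine le_iSup₂_of_le ((q : ℝ) - p) (sub_pos.2 (by exact_mod_cast hpq)) ?_
  exact WithTop.coe_le_coe.2 (derivRank_mono (fun F _ => isClosed_sepDeriv _ _ F)
    (fun F hF => sepDeriv_subset _ _ hF) (oscDeriv_mono f _)
    fun F hF => sepDeriv_subset_oscDeriv f p q hF)

lemma oscDeriv_subset_seqOscDeriv {f : X → ℝ} {g : ℕ → X → ℝ} (hg : ∀ n, Continuous (g n))
    (hlim : ∀ x, Tendsto (fun n => g n x) atTop (𝓝 (f x))) {ε : ℝ} (hε : 0 < ε) (F : Set X) :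
    oscDeriv f ε F ⊆ seqOscDeriv g (ε / 4) F := by
  intro x hx
  refine ⟨hx.1, ?_⟩
  by_contra hlt
  obtain ⟨U, hU, hxU, N, hN⟩ := seqOsc_lt_iff.1 (not_le.1 hlt)
  have h1 : ∀ y ∈ U ∩ F, |f y - g N y| ≤ ε / 4 := by
    intro y hy
    have hm : ∀ m, N ≤ m → |g m y - g N y| ≤ ε / 4 := by
      intro m hm
      have : ENNReal.ofReal |g m y - g N y| ≤ ENNReal.ofReal (ε / 4) := by
        refine le_trans ?_ hN.le
        exact le_iSup₂_of_le (f := fun n (_ : N ≤ n) => _) N le_rfl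
          (le_iSup₂_of_le (f := fun m (_ : N ≤ m) => _) m hm
            (le_iSup₂_of_le (f := fun y (_ : y ∈ U ∩ F) => _) y hy le_rfl))
      exact (ENNReal.ofReal_le_ofReal_iff (by positivity)).1 this
    exact le_of_tendsto ((hlim y).sub_const _).abs
      (eventually_atTop.2 ⟨N, hm⟩)
  -- On `V ∩ F`, f oscillates by at most 2·ε/4 + 2·ε/12 = 2ε/3, below the bound 3ε/4 used next.
  let V : Set X := U ∩ {y | |g N y - g N x| < ε / 12}
  have hV : IsOpen V := hU.inter
    (isOpen_lt ((hg N).sub continuous_const).abs continuous_const)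
  have hxV : x ∈ V := ⟨hxU, by simp only [mem_ofPred_eq, sub_self, abs_zero]; positivity⟩
  refine hx.2.not_gt (osc_lt_iff.2 ⟨V, hV, hxV, ?_⟩)
  refine lt_of_le_of_lt (b := ENNReal.ofReal (3 * ε / 4)) ?_
    ((ENNReal.ofReal_lt_ofReal_iff hε).2 (by linarith))
  refine iSup₂_le fun y hy => iSup₂_le fun z hz => ENNReal.ofReal_le_ofReal ?_
  have hy1 := abs_le.1 (h1 y ⟨hy.1.1, hy.2⟩)
  have hz1 := abs_le.1 (h1 z ⟨hz.1.1, hz.2⟩)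
  have hy2 : -(ε / 12) < g N y - g N x ∧ _ := abs_lt.1 (mem_ofPred.1 hy.1.2)
  have hz2 : -(ε / 12) < g N z - g N x ∧ _ := abs_lt.1 (mem_ofPred.1 hz.1.2)
  rw [abs_le]
  constructor <;> linarith [hy1.1, hy1.2, hz1.1, hz1.2, hy2.1, hy2.2, hz2.1, hz2.2]

/-- The oscillation rank is at most the convergence rank. -/
lemma oscRank_le_convRank [SecondCountableTopology X] (f : X → ℝ) : oscRank f ≤ convRank f := by
  refine le_iInf fun g => le_iInf₂ fun hg hlim => iSup₂_le fun ε hε => ?_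
  refine le_iSup₂_of_le (ε / 4) (by positivity) ?_
  exact WithTop.coe_le_coe.2 (derivRank_mono (fun F => isClosed_oscDeriv f ε)
    (fun F _ => oscDeriv_subset f ε F) (seqOscDeriv_mono g _)
    fun F _ => oscDeriv_subset_seqOscDeriv hg hlim hε F)

/-! ### Limit ranks and their monotonicity -/

section LimitRank

lemma limitRank_zero (ρ : (X → ℝ) → WithTop Ordinal.{0}) : limitRank ρ 0 = ρ := by
  simp [limitRank]

lemma limitRank_one (ρ : (X → ℝ) → WithTop Ordinal.{0}) : limitRank ρ 1 = ρ := by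
  have := Ordinal.limitRecOn_add_one (motive := fun _ => (X → ℝ) → WithTop Ordinal.{0}) 0
  rw [← zero_add (1 : Ordinal.{0}), limitRank, this, if_pos rfl]

lemma limitRank_add_one (ρ : (X → ℝ) → WithTop Ordinal.{0}) {η : Ordinal.{0}} (hη : η ≠ 0)
    (f : X → ℝ) :
    limitRank ρ (η + 1) f = ⨅ (g : ℕ → X → ℝ) (_ : ∀ n, IsBaireClass η (g n))
        (_ : ∀ x, Tendsto (fun n => g n x) atTop (𝓝 (f x))), ⨆ n, limitRank ρ η (g n) := by
  rw [limitRank, Ordinal.limitRecOn_add_one, if_neg hη]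
  rfl

lemma limitRank_limit (ρ : (X → ℝ) → WithTop Ordinal.{0}) {ξ : Ordinal.{0}}
    (hξ : Order.IsSuccLimit ξ) (f : X → ℝ) :
    limitRank ρ ξ f = ⨅ (g : ℕ → X → ℝ) (c : ℕ → Ordinal.{0}) (_ : ∀ n, c n < ξ)
        (_ : ∀ n, IsBaireClass (c n) (g n))
        (_ : ∀ n, ∀ ζ < c n, ¬ IsBaireClass ζ (g n))
        (_ : ∀ x, Tendsto (fun n => g n x) atTop (𝓝 (f x))),
        ⨆ n, limitRank ρ (c n) (g n) := by
  rw [limitRank, Ordinal.limitRecOn_limit _ _ _ _ hξ]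
  rfl

/-- The admissible approximating sequences do not depend on ρ, so both infima range over the same
family. -/
lemma limitRank_mono {ρ ρ' : (X → ℝ) → WithTop Ordinal.{0}} (h : ρ ≤ ρ') (ξ : Ordinal.{0}) :
    limitRank ρ ξ ≤ limitRank ρ' ξ := by
  induction ξ using WellFoundedLT.induction with
  | ind ξ ih =>
  intro f
  rcases Ordinal.zero_or_succ_or_isSuccLimit ξ with rfl | ⟨η, rfl⟩ | hξ
  · rw [limitRank_zero, limitRank_zero]
    exact h f
  · rw [Order.succ_eq_add_one]
    rcases eq_or_ne η 0 with rfl | hη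
    · rw [zero_add, limitRank_one, limitRank_one]
      exact h f
    · rw [limitRank_add_one _ hη, limitRank_add_one _ hη]
      exact iInf_mono fun g => iInf₂_mono fun _ _ => iSup_mono fun n =>
        ih η (Order.lt_add_one_iff.2 le_rfl) (g n)
  · rw [limitRank_limit _ hξ, limitRank_limit _ hξ]
    exact iInf₂_mono fun g c => iInf₂_mono fun hc _ => iInf₂_mono fun _ _ => iSup_mono fun n =>
      ih (c n) (hc n) (g n)

end LimitRank

end Closed

/-! ### Refutation sets and the diagonal limit -/

section Approximation

open Classical in
/-- The members of the finite family `F i`, `i ∈ s`, containing `x`. -/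
noncomputable def cellIndex {κ : Type*} (s : Finset κ) (F : κ → Set X) (x : X) : Finset κ :=
  s.filter fun i => x ∈ F i

lemma mem_cellIndex {κ : Type*} {s : Finset κ} {F : κ → Set X} {x : X} {i : κ} :
    i ∈ cellIndex s F x ↔ i ∈ s ∧ x ∈ F i := by
  simp [cellIndex]

/-- The open condition on `x` that the double sequence `a` has not yet refuted, at stage `n`,
that `|lim_l a m l x - lim_l a k l x| ≤ δ` for all `m ≥ k`. -/
def notRefuted (a : ℕ → ℕ → X → ℝ) (δ : ℝ) (k n : ℕ) : Set X :=
  ⋂ m ∈ Finset.Icc k n, ⋃ l ≥ n, {x | |a m l x - a k l x| < δ + 1 / ((n : ℝ) + 1)}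

lemma mem_notRefuted {a : ℕ → ℕ → X → ℝ} {δ : ℝ} {k n : ℕ} {x : X} :
    x ∈ notRefuted a δ k n ↔ ∀ m, k ≤ m → m ≤ n → ∃ l ≥ n,
      |a m l x - a k l x| < δ + 1 / ((n : ℝ) + 1) := by
  simp [notRefuted]

section Diagonal

variable {a : ℕ → ℕ → X → ℝ} {b : ℕ → X → ℝ} {x : X}

/-- The slack 1/(n+1) makes the tested inequality strict, so a valid index is never refuted. -/
lemma mem_notRefuted_of_forall (hab : ∀ k, Tendsto (fun l => a k l x) atTop (𝓝 (b k x)))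
    {δ : ℝ} {k : ℕ} (h : ∀ m ≥ k, |b m x - b k x| ≤ δ) (n : ℕ) : x ∈ notRefuted a δ k n := by
  refine mem_notRefuted.2 fun m hm _ => ?_
  have h1 : |b m x - b k x| < δ + 1 / ((n : ℝ) + 1) :=
    (h m hm).trans_lt (lt_add_of_pos_right _ Nat.one_div_pos_of_nat)
  obtain ⟨l, h2, h3⟩ := ((((hab m).sub (hab k)).abs.eventually_lt_const h1).and
    (eventually_ge_atTop n)).exists
  exact ⟨l, h3, h2⟩

/-- One violating m leaves a gap above δ, which eventually exceeds the slack for all l ≥ n. -/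
lemma eventually_notMem_notRefuted (hab : ∀ k, Tendsto (fun l => a k l x) atTop (𝓝 (b k x)))
    {δ : ℝ} {k : ℕ} (h : ¬ ∀ m ≥ k, |b m x - b k x| ≤ δ) :
    ∀ᶠ n in atTop, x ∉ notRefuted a δ k n := by
  push Not at h
  obtain ⟨m, hm, hlt⟩ := h
  obtain ⟨δ', h1, h2⟩ := exists_between hlt
  obtain ⟨L, hL⟩ := eventually_atTop.1
    (((hab m).sub (hab k)).abs.eventually_const_lt h2)
  obtain ⟨N, hN⟩ := exists_nat_one_div_lt (sub_pos.2 h1)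
  filter_upwards [eventually_ge_atTop m, eventually_ge_atTop L, eventually_ge_atTop N]
    with n hnm hnL hnN hx
  obtain ⟨l, hl, hlt⟩ := mem_notRefuted.1 hx m hm hnm
  have h3 := hL l (hnL.trans hl)
  have h4 := Nat.one_div_le_one_div (α := ℝ) hnN
  linarith

/-- The index pairs considered at stage `n`. -/
def stageIndex (n : ℕ) : Finset (ℕ × ℕ) := Finset.range (n + 1) ×ˢ Finset.range n

/-- The refuted index pairs `(j, k)`, at stage `n`, where `j` stands for the precision `2⁻ʲ`. -/
def refuted (a : ℕ → ℕ → X → ℝ) (n : ℕ) (p : ℕ × ℕ) : Set X := (notRefuted a ((1 / 2) ^ p.1) p.2 n)ᶜ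

/-- The least index not refuted for precision `2⁻ʲ`. -/
noncomputable def leastIndex (T : Finset (ℕ × ℕ)) (j : ℕ) : ℕ := sInf {k | (j, k) ∉ T}

/-- The least index not refuted, for precision `2⁻ʲ`, converges to the least valid one. -/
lemma exists_eventually_leastIndex
    (hab : ∀ k, Tendsto (fun l => a k l x) atTop (𝓝 (b k x))) {y : ℝ}
    (hb : Tendsto (fun k => b k x) atTop (𝓝 y)) (j : ℕ) :
    ∃ k, |b k x - y| ≤ (1 / 2) ^ j ∧
      ∀ᶠ n in atTop, leastIndex (cellIndex (stageIndex n) (refuted a n) x) j = k := by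
  classical
  have hex : ∃ k, ∀ m ≥ k, |b m x - b k x| ≤ (1 / 2 : ℝ) ^ j := by
    obtain ⟨N, hN⟩ := Metric.cauchySeq_iff'.1 hb.cauchySeq ((1 / 2 : ℝ) ^ j) (by positivity)
    exact ⟨N, fun m hm => (Real.dist_eq (b m x) (b N x) ▸ hN m hm).le⟩
  refine ⟨Nat.find hex, ?_, ?_⟩
  · rw [abs_sub_comm]
    exact le_of_tendsto (hb.sub_const _).abs (eventually_atTop.2 ⟨_, Nat.find_spec hex⟩)
  · have hlt : ∀ᶠ n in atTop, ∀ k ∈ Finset.range (Nat.find hex),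
        x ∉ notRefuted a ((1 / 2) ^ j) k n :=
      (Finset.eventually_all _).2 fun k hk =>
        eventually_notMem_notRefuted hab (Nat.find_min hex (Finset.mem_range.1 hk))
    filter_upwards [hlt, eventually_ge_atTop j, eventually_ge_atTop (Nat.find hex)]
      with n hn hj hk
    refine le_antisymm (Nat.sInf_le fun h => ?_) (le_csInf ⟨n, fun h => ?_⟩ fun k hkT => ?_)
    · exact (mem_cellIndex.1 h).2 (mem_notRefuted_of_forall hab (Nat.find_spec hex) n)
    · simpa [stageIndex] using (mem_cellIndex.1 h).1
    · by_contra! hlt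
      refine hkT (mem_cellIndex.2 ⟨?_, hn k (Finset.mem_range.2 hlt)⟩)
      simp only [stageIndex, Finset.mem_product, Finset.mem_range]
      omega

/-- Truncation to the interval `[-c, c]`. -/
def clamp (c t : ℝ) : ℝ := max (-c) (min c t)

lemma continuous_clamp (c : ℝ) : Continuous (clamp c) :=
  continuous_const.max (continuous_const.min continuous_id)

lemma abs_clamp_le {c : ℝ} (hc : 0 ≤ c) (t : ℝ) : |clamp c t| ≤ c :=
  abs_le.2 ⟨le_max_left _ _, max_le (by linarith) (min_le_left _ _)⟩

lemma clamp_eq_self {c t : ℝ} (h : |t| ≤ c) : clamp c t = t := by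
  rw [clamp, min_eq_right (abs_le.1 h).2, max_eq_right (abs_le.1 h).1]

/-- Uniformly fast converging limits can be interchanged after truncating the increments. -/
lemma tendsto_clamp_diagonal {v : ℕ → ℕ → ℝ} {w : ℕ → ℝ} {y : ℝ}
    (hv : ∀ j, Tendsto (fun n => v j n) atTop (𝓝 (w j))) (hw : ∀ j, |w j - y| ≤ (1 / 2) ^ j) :
    Tendsto (fun n => v 0 n +
      ∑ j ∈ Finset.range n, clamp (2 * (1 / 2) ^ j) (v (j + 1) n - v j n)) atTop (𝓝 y) := by
  have hwy : Tendsto w atTop (𝓝 y) := by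
    rw [tendsto_iff_norm_sub_tendsto_zero]
    exact squeeze_zero (fun _ => norm_nonneg _) hw
      (tendsto_pow_atTop_nhds_zero_of_lt_one (by norm_num) (by norm_num))
  have hinc : ∀ j, |w (j + 1) - w j| ≤ 2 * (1 / 2) ^ j := by
    intro j
    have h1 := abs_le.1 (hw (j + 1))
    have h2 := abs_le.1 (hw j)
    have h3 : (1 / 2 : ℝ) ^ (j + 1) ≤ (1 / 2) ^ j :=
      pow_le_pow_of_le_one (by norm_num) (by norm_num) (Nat.le_succ j)
    exact abs_le.2 ⟨by linarith [h1.1, h2.2], by linarith [h1.2, h2.1]⟩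
  have hsum : Summable fun j : ℕ => 2 * (1 / 2 : ℝ) ^ j := summable_geometric_two.mul_left 2
  have htel : ∑' j, (w (j + 1) - w j) = y - w 0 := by
    refine tendsto_nhds_unique
      (Summable.of_norm_bounded hsum hinc).hasSum.tendsto_sum_nat ?_
    simp_rw [Finset.sum_range_sub]
    exact hwy.sub_const _
  have hdom := tendsto_tsum_of_dominated_convergence (𝓕 := atTop)
    (f := fun n j => if j < n then clamp (2 * (1 / 2) ^ j) (v (j + 1) n - v j n) else 0)
    (g := fun j => w (j + 1) - w j) hsum (fun j => ?_) (.of_forall fun n j => ?_)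
  · have := (hv 0).add hdom
    rw [htel, add_sub_cancel] at this
    refine this.congr fun n => ?_
    rw [tsum_eq_sum (s := Finset.range n) fun j hj => if_neg (by simpa using hj)]
    congr 1
    exact Finset.sum_congr rfl fun j hj => if_pos (Finset.mem_range.1 hj)
  · have h := ((continuous_clamp (2 * (1 / 2) ^ j)).tendsto _).comp ((hv (j + 1)).sub (hv j))
    rw [clamp_eq_self (hinc j)] at h
    refine h.congr' ?_
    filter_upwards [eventually_gt_atTop j] with n hn
    simp [hn]
  · split_ifs
    · exact abs_clamp_le (by positivity) _
    · simp

end Diagonal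

variable [TopologicalSpace X]

lemma exists_continuous_approx_indicator [TopologicalSpace.MetrizableSpace X] {F : Set X}
    (hF : IsClosed F) :
    ∃ u : ℕ → X → ℝ, (∀ n, Continuous (u n)) ∧ (∀ n, ∀ x ∈ F, u n x = 1) ∧
      ∀ x ∉ F, ∃ U, IsOpen U ∧ x ∈ U ∧ ∃ N, ∀ n ≥ N, ∀ y ∈ U, u n y = 0 := by
  let _ : MetricSpace X := TopologicalSpace.metrizableSpaceMetric X
  have hpos : ∀ n : ℕ, (0 : ℝ) < 1 / ((n : ℝ) + 1) := fun n => Nat.one_div_pos_of_nat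
  refine ⟨fun n x => (thickenedIndicator (hpos n) F x : ℝ), fun n => ?_, fun n x hx => ?_,
    fun x hx => ?_⟩
  · exact NNReal.continuous_coe.comp (thickenedIndicator (hpos n) F).continuous
  · exact congrArg NNReal.toReal (thickenedIndicator_one (hpos n) F hx)
  · obtain ⟨ε, hε, hball⟩ := Metric.isOpen_iff.1 hF.isOpen_compl x hx
    obtain ⟨N, hN⟩ := exists_nat_one_div_lt (half_pos hε)
    refine ⟨Metric.ball x (ε / 2), Metric.isOpen_ball, Metric.mem_ball_self (half_pos hε), N,
      fun n hn y hy => ?_⟩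
    have hy' : y ∉ Metric.thickening (1 / ((n : ℝ) + 1)) F := by
      intro hmem
      obtain ⟨z, hz, hyz⟩ := Metric.mem_thickening_iff.1 hmem
      refine hball ?_ hz
      have h1 := Nat.one_div_le_one_div (α := ℝ) hn
      have h2 := Metric.mem_ball.1 hy
      have h3 := dist_triangle z y x
      rw [dist_comm z y] at h3
      exact Metric.mem_ball.2 (by linarith)
    exact congrArg NNReal.toReal (thickenedIndicator_zero (hpos n) F hy')

/-- A function which is continuous on each cell of a finite family of closed sets is approximated
by continuous functions that are, near each point `x` and on the cell of `x`, eventually equal to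
it. -/
lemma exists_continuous_approx_cell [TopologicalSpace.MetrizableSpace X] {κ : Type*}
    (s : Finset κ) {F : κ → Set X} (hF : ∀ i, IsClosed (F i)) {Φ : Finset κ → X → ℝ}
    (hΦ : ∀ T, Continuous (Φ T)) :
    ∃ g : ℕ → X → ℝ, (∀ n, Continuous (g n)) ∧ ∀ x, ∃ U, IsOpen U ∧ x ∈ U ∧
      (∀ y ∈ U, cellIndex s F y ⊆ cellIndex s F x) ∧
      ∃ N, ∀ n ≥ N, ∀ y ∈ U, cellIndex s F y = cellIndex s F x →
        g n y = Φ (cellIndex s F x) y := by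
  classical
  choose u hu hu1 hu0 using fun i => exists_continuous_approx_indicator (hF i)
  refine ⟨fun n x => ∑ T ∈ s.powerset, Φ T x * ∏ i ∈ s, if i ∈ T then u i n x else 1 - u i n x,
    fun n => ?_, fun x => ?_⟩
  · refine continuous_finsetSum _ fun T _ => (hΦ T).mul (continuous_finsetProd _ fun i _ => ?_)
    split_ifs
    · exact hu i n
    · exact continuous_const.sub (hu i n)
  · have hloc : ∀ i, ∃ U, IsOpen U ∧ x ∈ U ∧
        ∃ N, x ∉ F i → (∀ n ≥ N, ∀ y ∈ U, u i n y = 0) ∧ ∀ y ∈ U, y ∉ F i := by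
      intro i
      by_cases hx : x ∈ F i
      · exact ⟨univ, isOpen_univ, mem_univ x, 0, fun h => (h hx).elim⟩
      · obtain ⟨U, hU, hxU, N, h⟩ := hu0 i x hx
        exact ⟨U ∩ (F i)ᶜ, hU.inter (hF i).isOpen_compl, ⟨hxU, hx⟩, N,
          fun _ => ⟨fun n hn y hy => h n hn y hy.1, fun y hy => hy.2⟩⟩
    choose U hU hxU N hN using hloc
    refine ⟨⋂ i ∈ s, U i, isOpen_biInter_finset fun i _ => hU i, mem_iInter₂.2 fun i _ => hxU i,
      fun y hy i hi => ?_, s.sup N, fun n hn y hy hT => ?_⟩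
    · rw [mem_cellIndex] at hi ⊢
      refine ⟨hi.1, ?_⟩
      by_contra hx
      exact (hN i hx).2 y (mem_iInter₂.1 hy i hi.1) hi.2
    · have hval : ∀ i ∈ s, u i n y = if i ∈ cellIndex s F x then 1 else 0 := by
        intro i hi
        split_ifs with h
        · rw [← hT, mem_cellIndex] at h
          exact hu1 i n y h.2
        · refine (hN i fun hx => h (mem_cellIndex.2 ⟨hi, hx⟩)).1 n
            ((Finset.le_sup hi).trans hn) y (mem_iInter₂.1 hy i hi)
      have hsub : cellIndex s F x ⊆ s := fun i hi => (mem_cellIndex.1 hi).1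
      show ∑ T ∈ s.powerset, Φ T y * ∏ i ∈ s, (if i ∈ T then u i n y else 1 - u i n y) = _
      rw [Finset.sum_eq_single_of_mem (cellIndex s F x) (Finset.mem_powerset.2 hsub)]
      · rw [Finset.prod_eq_one, mul_one]
        intro i hi
        rw [hval i hi]
        split_ifs <;> simp
      · intro T hTs hne
        have : ∃ i ∈ s, ¬ (i ∈ T ↔ i ∈ cellIndex s F x) := by
          by_contra! h
          refine hne (Finset.ext fun i => ?_)
          by_cases hi : i ∈ s
          · exact h i hi
          · exact iff_of_false (fun h => hi (Finset.mem_powerset.1 hTs h)) fun h => hi (hsub h)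
        obtain ⟨i, hi, hiT⟩ := this
        rw [Finset.prod_eq_zero hi, mul_zero]
        rw [hval i hi]
        by_cases h1 : i ∈ T <;> by_cases h2 : i ∈ cellIndex s F x <;> simp_all

/-- A function which is continuous on each cell of a finite family of closed sets is of Baire
class `1`, with finite convergence rank. -/
lemma convRank_cell_le [TopologicalSpace.MetrizableSpace X] {κ : Type*}
    (s : Finset κ) {F : κ → Set X} (hF : ∀ i, IsClosed (F i)) {Φ : Finset κ → X → ℝ}
    (hΦ : ∀ T, Continuous (Φ T)) :
    IsBaireClass 1 (fun x => Φ (cellIndex s F x) x) ∧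
      convRank (fun x => Φ (cellIndex s F x) x) ≤
        ((Ordinal.omega0 : Ordinal.{0}) : WithTop Ordinal.{0}) := by
  obtain ⟨g, hg, hloc⟩ := exists_continuous_approx_cell s hF hΦ
  have hlim : ∀ x, Tendsto (fun n => g n x) atTop (𝓝 (Φ (cellIndex s F x) x)) := by
    intro x
    obtain ⟨U, -, hxU, -, N, hN⟩ := hloc x
    exact tendsto_atTop_of_eventually_const (i₀ := N) fun n hn => hN n hn x hxU rfl
  refine ⟨.limit 1 _ (fun _ => 0) g (fun _ => zero_lt_one) (fun n => .continuous _ (hg n)) hlim,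
    iInf_le_of_le g (iInf₂_le_of_le hg hlim (iSup₂_le fun ε hε => WithTop.coe_le_coe.2 ?_))⟩
  refine (derivRank_le_natCast (seqOscDeriv_mono g ε) (fun j => {x | j ≤ (cellIndex s F x).card})
    (by simp) (fun j x hx => ?_) (N := s.card + 1) ?_).trans (Ordinal.natCast_lt_omega0 _).le
  · by_contra hlt
    obtain ⟨hxj, hosc⟩ := hx
    have hcard : (cellIndex s F x).card = j := by
      have h1 : j ≤ (cellIndex s F x).card := hxj
      have h2 : ¬ j + 1 ≤ (cellIndex s F x).card := hlt
      omega
    obtain ⟨U, hU, hxU, hsub, N, hN⟩ := hloc x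
    refine hosc.not_gt (seqOsc_lt_iff.2 ⟨U, hU, hxU, N, ?_⟩)
    refine lt_of_le_of_lt ?_ (ENNReal.ofReal_pos.2 hε)
    refine iSup₂_le fun n hn => iSup₂_le fun m hm => iSup₂_le fun y hy => ?_
    have hT : cellIndex s F y = cellIndex s F x := by
      refine Finset.eq_of_subset_of_card_le (hsub y hy.1) ?_
      rw [hcard]
      exact hy.2
    rw [hN n hn y hy.1 hT, hN m hm y hy.1 hT]
    simp
  · refine eq_empty_of_forall_notMem fun x hx => ?_
    have h1 : s.card + 1 ≤ (cellIndex s F x).card := hx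
    have h2 : (cellIndex s F x).card ≤ s.card :=
      Finset.card_le_card fun i hi => (mem_cellIndex.1 hi).1
    omega

lemma IsBaireClass.exists_seq {ξ : Ordinal.{0}} (hξ : 0 < ξ) {f : X → ℝ}
    (hf : IsBaireClass ξ f) :
    ∃ (c : ℕ → Ordinal.{0}) (g : ℕ → X → ℝ), (∀ n, c n < ξ) ∧ (∀ n, IsBaireClass (c n) (g n)) ∧
      ∀ x, Tendsto (fun n => g n x) atTop (𝓝 (f x)) := by
  cases hf with
  | continuous _ h => exact (lt_irrefl _ hξ).elim
  | limit _ _ c g hc hg hlim => exact ⟨c, g, hc, hg, hlim⟩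

lemma IsBaireClass.mono {ξ ζ : Ordinal.{0}} (h : ξ ≤ ζ) {f : X → ℝ} (hf : IsBaireClass ξ f) :
    IsBaireClass ζ f := by
  rcases h.lt_or_eq with h | rfl
  · exact .limit ζ f (fun _ => ξ) (fun _ => f) (fun _ => h) (fun _ => hf)
      fun x => tendsto_const_nhds
  · exact hf

lemma IsBaireClass.exists_seq_add_one {η : Ordinal.{0}} {f : X → ℝ}
    (hf : IsBaireClass (η + 1) f) :
    ∃ g : ℕ → X → ℝ, (∀ n, IsBaireClass η (g n)) ∧
      ∀ x, Tendsto (fun n => g n x) atTop (𝓝 (f x)) := by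
  obtain ⟨c, g, hc, hg, hlim⟩ := hf.exists_seq (by simp)
  exact ⟨g, fun n => (hg n).mono (Order.lt_add_one_iff.1 (hc n)), hlim⟩

lemma IsBaireClass.continuous_of_zero {f : X → ℝ} (hf : IsBaireClass 0 f) : Continuous f := by
  cases hf with
  | continuous _ h => exact h
  | limit _ _ c g hc hg hlim => exact (not_lt_zero (hc 0)).elim

lemma isOpen_notRefuted {a : ℕ → ℕ → X → ℝ} (ha : ∀ k l, Continuous (a k l)) (δ : ℝ) (k n : ℕ) :
    IsOpen (notRefuted a δ k n) :=
  isOpen_biInter_finset fun m _ => isOpen_biUnion fun l _ =>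
    isOpen_lt ((ha m l).sub (ha k l)).abs continuous_const

/-- Every function of Baire class `2` is a pointwise limit of functions of Baire class `1` whose
convergence rank is at most `ω`. -/
lemma IsBaireClass.exists_seq_convRank_le [TopologicalSpace.MetrizableSpace X] {f : X → ℝ}
    (hf : IsBaireClass 2 f) :
    ∃ g : ℕ → X → ℝ, (∀ n, IsBaireClass 1 (g n)) ∧
      (∀ n, convRank (g n) ≤ ((Ordinal.omega0 : Ordinal.{0}) : WithTop Ordinal.{0})) ∧
      ∀ x, Tendsto (fun n => g n x) atTop (𝓝 (f x)) := by
  rw [← one_add_one_eq_two] at hf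
  obtain ⟨b, hb, hbf⟩ := hf.exists_seq_add_one
  have hb' : ∀ k, ∃ g : ℕ → X → ℝ, (∀ n, IsBaireClass 0 (g n)) ∧
      ∀ x, Tendsto (fun n => g n x) atTop (𝓝 (b k x)) := by
    intro k
    refine IsBaireClass.exists_seq_add_one ?_
    rw [zero_add]
    exact hb k
  choose a ha hab using hb'
  have ha' : ∀ k l, Continuous (a k l) := fun k l => (ha k l).continuous_of_zero
  let Φ : ℕ → Finset (ℕ × ℕ) → X → ℝ := fun n T x => a (leastIndex T 0) n x +
    ∑ j ∈ Finset.range n, clamp (2 * (1 / 2) ^ j)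
      (a (leastIndex T (j + 1)) n x - a (leastIndex T j) n x)
  have hΦ : ∀ n T, Continuous (Φ n T) := fun n T =>
    (ha' _ _).add (continuous_finsetSum _ fun j _ =>
      (continuous_clamp _).comp ((ha' _ _).sub (ha' _ _)))
  have hcell := fun n => convRank_cell_le (stageIndex n) (F := refuted a n)
    (fun p => (isOpen_notRefuted ha' _ _ _).isClosed_compl) (hΦ n)
  refine ⟨_, fun n => (hcell n).1, fun n => (hcell n).2, fun x => ?_⟩
  choose k hk hlim using
    exists_eventually_leastIndex (fun k => hab k x) (hbf x)
  refine tendsto_clamp_diagonal (w := fun j => b (k j) x) (v := fun j n =>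
    a (leastIndex (cellIndex (stageIndex n) (refuted a n) x) j) n x) (fun j => ?_) hk
  refine (hab (k j) x).congr' ?_
  filter_upwards [hlim j] with n hn
  rw [hn]

/-- At every level at least `2` the limit rank built from the convergence rank is at most `ω`. -/
lemma limitRank_convRank_le [TopologicalSpace.MetrizableSpace X] (ξ : Ordinal.{0}) (hξ : 2 ≤ ξ)
    (f : X → ℝ) (hf : IsBaireClass ξ f) :
    limitRank convRank ξ f ≤ ((Ordinal.omega0 : Ordinal.{0}) : WithTop Ordinal.{0}) := by
  induction ξ using WellFoundedLT.induction generalizing f with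
  | ind ξ ih =>
  rcases Ordinal.zero_or_succ_or_isSuccLimit ξ with rfl | ⟨η, rfl⟩ | hlim
  · simp at hξ
  · rw [Order.succ_eq_add_one] at *
    have hη : 1 ≤ η := by
      rw [← one_add_one_eq_two] at hξ
      exact Order.lt_add_one_iff.1 (Order.add_one_le_iff.1 hξ)
    rw [limitRank_add_one _ (Order.one_le_iff_pos.1 hη).ne']
    rcases hη.lt_or_eq with h | rfl
    · obtain ⟨g, hg, hgf⟩ := hf.exists_seq_add_one
      have h2 : 2 ≤ η := by
        rw [← one_add_one_eq_two]
        exact Order.add_one_le_of_lt h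
      exact iInf_le_of_le g (iInf₂_le_of_le hg hgf (iSup_le fun n =>
        ih η (Order.lt_add_one_iff.2 le_rfl) h2 _ (hg n)))
    · rw [one_add_one_eq_two] at hf
      obtain ⟨g, hg, hγ, hgf⟩ := hf.exists_seq_convRank_le
      refine iInf_le_of_le g (iInf₂_le_of_le hg hgf (iSup_le fun n => ?_))
      rw [limitRank_one]
      exact hγ n
  · -- It suffices to approximate by functions whose rank is small at their exact class.
    have key : ∀ g : ℕ → X → ℝ, (∀ n, ∃ c < ξ, IsBaireClass c (g n) ∧
        (∀ ζ < c, ¬ IsBaireClass ζ (g n)) ∧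
        limitRank convRank c (g n) ≤ ((Ordinal.omega0 : Ordinal.{0}) : WithTop Ordinal.{0})) →
        (∀ x, Tendsto (fun n => g n x) atTop (𝓝 (f x))) →
        limitRank convRank ξ f ≤ ((Ordinal.omega0 : Ordinal.{0}) : WithTop Ordinal.{0}) := by
      intro g hg hgf
      choose c hc hc1 hc2 hc3 using hg
      rw [limitRank_limit _ hlim]
      exact iInf₂_le_of_le g c (iInf₂_le_of_le hc hc1 (iInf₂_le_of_le hc2 hgf (iSup_le hc3)))
    have exact_class : ∀ {ζ : Ordinal.{0}} {h : X → ℝ}, IsBaireClass ζ h →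
        ∃ c ≤ ζ, IsBaireClass c h ∧ ∀ θ < c, ¬ IsBaireClass θ h := by
      intro ζ h hh
      exact ⟨sInf {c | IsBaireClass c h}, csInf_le' hh, csInf_mem (s := {c | IsBaireClass c h})
        ⟨ζ, hh⟩, fun θ hθ h' => notMem_of_lt_csInf' hθ h'⟩
    have hξ2 : 2 < ξ := hξ.lt_of_ne fun h => by
      rw [← h, ← one_add_one_eq_two] at hlim
      exact Order.not_isSuccLimit_add_one _ hlim
    obtain ⟨c, g, hc, hg, hgf⟩ := hf.exists_seq (two_pos.trans_le hξ)
    by_cases hfreq : ∃ᶠ n in atTop, IsBaireClass 1 (g n)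
    · obtain ⟨φ, hφ, hφ1⟩ := extraction_of_frequently_atTop hfreq
      have hf2 : IsBaireClass 2 f := .limit 2 f (fun _ => 1) (fun n => g (φ n))
        (fun _ => one_lt_two) hφ1 fun x => (hgf x).comp hφ.tendsto_atTop
      obtain ⟨h, hh, hγ, hhf⟩ := hf2.exists_seq_convRank_le
      refine key h (fun n => ?_) hhf
      obtain ⟨d, hd, hd1, hd2⟩ := exact_class (hh n)
      refine ⟨d, (hd.trans_lt one_lt_two).trans hξ2, hd1, hd2, ?_⟩
      rcases hd.lt_or_eq with hd | rfl
      · rw [Order.lt_one_iff.1 hd, limitRank_zero]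
        exact hγ n
      · rw [limitRank_one]
        exact hγ n
    · obtain ⟨N, hN⟩ := eventually_atTop.1 (not_frequently.1 hfreq)
      refine key (fun n => g (n + N)) (fun n => ?_) fun x => (hgf x).comp (tendsto_add_atTop_nat N)
      obtain ⟨d, hd, hd1, hd2⟩ := exact_class (hg (n + N))
      have hdξ := hd.trans_lt (hc _)
      refine ⟨d, hdξ, hd1, hd2, ih d hdξ ?_ _ hd1⟩
      by_contra hlt
      rw [not_le, ← one_add_one_eq_two, Order.lt_add_one_iff] at hlt
      exact hN (n + N) (Nat.le_add_left _ _) (hd1.mono hlt)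

end Approximation

end BaireRanks

theorem theoremt {X : Type*} [TopologicalSpace X] [PolishSpace X] [Uncountable X]
    (ξ : Ordinal.{0}) (hξ₂ : 2 ≤ ξ) (hξ : ξ < Ordinal.omega 1)
    (f : X → ℝ) (hf : BaireRanks.IsBaireClass ξ f) :
    BaireRanks.limitRank BaireRanks.sepRank ξ f ≤ BaireRanks.limitRank BaireRanks.oscRank ξ f ∧
    BaireRanks.limitRank BaireRanks.oscRank ξ f ≤ BaireRanks.limitRank BaireRanks.convRank ξ f ∧
    BaireRanks.limitRank BaireRanks.convRank ξ f ≤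
      ((Ordinal.omega0 : Ordinal.{0}) : WithTop Ordinal.{0}) :=
  ⟨BaireRanks.limitRank_mono BaireRanks.sepRank_le_oscRank ξ f,
    BaireRanks.limitRank_mono BaireRanks.oscRank_le_convRank ξ f,
    BaireRanks.limitRank_convRank_le ξ hξ₂ f hf⟩
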